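/- \textbf{Theorem (Optimal Unpredictability Hardcore Lemma).} A Boolean circuit on $n$ input bits is a directed acyclic graph whose vertices are input bits, constants, or arbitrary Boolean gates of fan-in two, one vertex being the output; its size is its number of vertices. There is an absolute constant $c>0$ such that the following holds. Let $n\in\mathbb{N}$, let $V$ be a probability distribution on $\{0,1\}^n$, let $f:\{0,1\}^n\to\{0,1\}$, let $s\in\mathbb{N}$ and $\epsilon\in(0,1]$, and suppose that $f$ is $\epsilon$-unpredictable under $V$ by circuits of size $s$, that is, $$\Pr_{x\leftarrow V}[A(x)=f(x)]\le 1-\frac{\epsilon}{2}\qquad\text{for every circuit } A \text{ of size at most } s.$$ Then for every $\delta\in(0,1)$ there is an event $E$ of probability exactly $\epsilon$ (on a probability space carrying a random variable $x$ with distribution $V$; $E$ need not be determined by $x$) such that $$\Pr_{x\leftarrow V|E}[A(x)=f(x)]\le\frac{1+\delta}{2}\qquad\text{for every circuit } A \text{ of size at most } s'=c\cdot\frac{s\,\delta^{2}}{\log(2/\epsilon)},$$ where $V|E$ denotes the distribution of $x$ conditioned on $E$. (For $\epsilon\le\frac12$ one has $\log(2/\epsilon)\le 2\log(1/\epsilon)$,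 so this is $s'=\Omega(s\delta^2/\log(1/\epsilon))$.) -/

import Mathlib

open MeasureTheory ProbabilityTheory

/-- A vertex of a Boolean circuit on `n` input bits, at a position preceded by `k` other vertices:
an input bit, a constant, or a gate of fan-in two (of arbitrary Boolean type) that reads two earlier
vertices. The two vertices read by a gate may coincide, so negation is a gate too. -/
inductive CircuitNode (n k : ℕ) : Type where
  | input (i : Fin n) : CircuitNode n k
  | const (b : Bool) : CircuitNode n k
  | gate (op : Bool → Bool → Bool) (i j : Fin k) : CircuitNode n k

/-- The value of a vertex on the input `x`, given the values `w` of the `k` earlier vertices. -/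
def CircuitNode.value {n k : ℕ} (x : Fin n → Bool) (w : Fin k → Bool) : CircuitNode n k → Bool
  | .input i => x i
  | .const b => b
  | .gate op i j => op (w i) (w j)

/-- A Boolean circuit with `k` vertices, listed in a topological order; the value of a vertex may be
used by any number of later vertices. -/
inductive CircuitGraph (n : ℕ) : ℕ → Type where
  | nil : CircuitGraph n 0
  | snoc {k : ℕ} (P : CircuitGraph n k) (v : CircuitNode n k) : CircuitGraph n (k + 1)

/-- The values of all vertices on the input `x`. -/
def CircuitGraph.values {n : ℕ} (x : Fin n → Bool) :
    {k : ℕ} → CircuitGraph n k → (Fin k → Bool)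
  | _, .nil => Fin.elim0
  | _, .snoc P v => Fin.snoc (α := fun _ => Bool) (P.values x) (v.value x (P.values x))

/-- A Boolean circuit on `n` input bits with one output bit, the value of the last vertex. In
particular it has at least one vertex. -/
structure BoolCircuit (n : ℕ) where
  pred : ℕ
  graph : CircuitGraph n (pred + 1)

/-- The size of a circuit: its number of vertices. -/
def BoolCircuit.size {n : ℕ} (A : BoolCircuit n) : ℕ := A.pred + 1

/-- The Boolean function computed by a circuit. -/
def BoolCircuit.eval {n : ℕ} (A : BoolCircuit n) (x : Fin n → Bool) : Bool :=
  A.graph.values x (Fin.last A.pred)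

/-! Suppose no event of mass `ε` is hardcore. Then every density of mass `ε` is predicted with
advantage `δ` by some small circuit, and boosting turns these circuits into a predictor failing with
probability below `ε / 2`. The potential is `ε r + E[cappedExp (F - r)]`, where `F` is `-δ/2` times
the sum of the agreements so far. At the minimising `r`, the weights `min 1 (exp (F - r))` form a
density of mass exactly `ε`; a circuit correlated with it lowers the potential by `ε δ² / 4`
(`exists_boosting`). The potential starts at `ε (log (1/ε) + 1)`, so it is negative after `O(log
(2/ε) / δ²)` rounds. A negative potential bounds the mean hinge loss at some margin `θ` by less than
`ε θ`. A uniformly random threshold in `[-θ, θ]`, unlike a plain majority, then fails with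
probability below `ε / 2` (`exists_threshold_failure_lt`). Adders compute the threshold in linear
size (`JointlyComputable.threshold`), so combining the circuits costs only a constant factor. -/

/-- The functions in `S` are all computed by vertices of one circuit graph with at most `k`
vertices. -/
def JointlyComputable (n k : ℕ) (S : Set ((Fin n → Bool) → Bool)) : Prop :=
  ∃ l ≤ k, ∃ P : CircuitGraph n l, ∀ g ∈ S, ∃ i, ∀ x, P.values x i = g x

/-- The number of functions in the list `L` (with multiplicity) that are true at `x`. -/
def trueCount {n : ℕ} (L : List ((Fin n → Bool) → Bool)) (x : Fin n → Bool) : ℕ :=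
  (L.map fun g => (g x).toNat).sum

@[simp] theorem trueCount_nil {n : ℕ} (x : Fin n → Bool) : trueCount [] x = 0 := rfl

@[simp] theorem trueCount_cons {n : ℕ} (g : (Fin n → Bool) → Bool)
    (L : List ((Fin n → Bool) → Bool)) (x : Fin n → Bool) :
    trueCount (g :: L) x = (g x).toNat + trueCount L x := by
  simp [trueCount]

theorem CircuitGraph.values_snoc_castSucc {n k : ℕ} (P : CircuitGraph n k) (v : CircuitNode n k)
    (x : Fin n → Bool) (i : Fin k) : (P.snoc v).values x i.castSucc = P.values x i := by
  simp [CircuitGraph.values]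

theorem CircuitGraph.values_snoc_last {n k : ℕ} (P : CircuitGraph n k) (v : CircuitNode n k)
    (x : Fin n → Bool) : (P.snoc v).values x (Fin.last k) = v.value x (P.values x) := by
  simp [CircuitGraph.values]

/-- Two circuit graphs can be put side by side. -/
theorem CircuitGraph.exists_append {n k l : ℕ} (P : CircuitGraph n k) (Q : CircuitGraph n l) :
    ∃ R : CircuitGraph n (k + l), (∀ i x, R.values x (Fin.castAdd l i) = P.values x i) ∧
      ∀ j x, R.values x (Fin.natAdd k j) = Q.values x j := by
  induction Q with
  | nil => exact ⟨P, fun _ _ => rfl, fun j => j.elim0⟩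
  | @snoc l Q v ih =>
    obtain ⟨R, hP, hQ⟩ := ih
    obtain ⟨w, hw⟩ : ∃ w : CircuitNode n (k + l),
        ∀ x, w.value x (R.values x) = v.value x (Q.values x) := by
      cases v with
      | input i => exact ⟨.input i, fun _ => rfl⟩
      | const b => exact ⟨.const b, fun _ => rfl⟩
      | gate op i j =>
        exact ⟨.gate op (Fin.natAdd k i) (Fin.natAdd k j), fun x => by
          simp [CircuitNode.value, hQ]⟩
    refine ⟨R.snoc w, fun i x => ?_, fun j x => ?_⟩
    · exact (values_snoc_castSucc R w x (Fin.castAdd l i)).trans (hP i x)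
    · induction j using Fin.lastCases with
      | last =>
        rw [values_snoc_last, ← hw x]
        exact values_snoc_last R w x
      | cast j =>
        rw [values_snoc_castSucc, ← hQ j x]
        exact values_snoc_castSucc R w x (Fin.natAdd k j)

/-! ### Circuits with shared vertices, and threshold circuits of linear size -/

namespace JointlyComputable

variable {n k l : ℕ} {S T : Set ((Fin n → Bool) → Bool)}

theorem mono (h : JointlyComputable n k S) (hkl : k ≤ l) (hTS : T ⊆ S) :
    JointlyComputable n l T := by
  obtain ⟨m, hm, P, hP⟩ := h
  exact ⟨m, hm.trans hkl, P, fun g hg => hP g (hTS hg)⟩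

theorem empty : JointlyComputable n 0 ∅ := ⟨0, le_rfl, .nil, by simp⟩

theorem union (hS : JointlyComputable n k S) (hT : JointlyComputable n l T) :
    JointlyComputable n (k + l) (S ∪ T) := by
  obtain ⟨k', hk, P, hP⟩ := hS
  obtain ⟨l', hl, Q, hQ⟩ := hT
  obtain ⟨R, hRP, hRQ⟩ := P.exists_append Q
  refine ⟨k' + l', by omega, R, ?_⟩
  rintro g (hg | hg)
  · obtain ⟨i, hi⟩ := hP g hg
    exact ⟨_, fun x => (hRP i x).trans (hi x)⟩
  · obtain ⟨i, hi⟩ := hQ g hg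
    exact ⟨_, fun x => (hRQ i x).trans (hi x)⟩

/-- Extending one common graph lets new gates reuse the values already computed, at a cost of one
vertex each. -/
theorem insert_node (h : JointlyComputable n k S) {g : (Fin n → Bool) → Bool}
    (hg : ∀ {m} (P : CircuitGraph n m), (∀ a ∈ S, ∃ i, ∀ x, P.values x i = a x) →
      ∃ v : CircuitNode n m, ∀ x, v.value x (P.values x) = g x) :
    JointlyComputable n (k + 1) (insert g S) := by
  obtain ⟨m, hm, P, hP⟩ := h
  obtain ⟨v, hv⟩ := hg P hP
  refine ⟨m + 1, by omega, P.snoc v, ?_⟩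
  rintro a (rfl | ha)
  · exact ⟨Fin.last m, fun x => (P.values_snoc_last v x).trans (hv x)⟩
  · obtain ⟨i, hi⟩ := hP a ha
    exact ⟨i.castSucc, fun x => (P.values_snoc_castSucc v x i).trans (hi x)⟩

theorem insert_const (h : JointlyComputable n k S) (b : Bool) :
    JointlyComputable n (k + 1) (insert (fun _ => b) S) :=
  h.insert_node fun _ _ => ⟨.const b, fun _ => rfl⟩

theorem insert_gate (h : JointlyComputable n k S) (op : Bool → Bool → Bool)
    {a b : (Fin n → Bool) → Bool} (ha : a ∈ S) (hb : b ∈ S) :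
    JointlyComputable n (k + 1) (insert (fun x => op (a x) (b x)) S) :=
  h.insert_node fun P hP => by
    obtain ⟨i, hi⟩ := hP a ha
    obtain ⟨j, hj⟩ := hP b hb
    exact ⟨.gate op i j, fun x => by simp [CircuitNode.value, hi, hj]⟩

theorem of_circuit (A : BoolCircuit n) : JointlyComputable n A.size {A.eval} :=
  ⟨A.size, le_rfl, A.graph, by rintro g rfl; exact ⟨Fin.last _, fun _ => rfl⟩⟩

theorem of_circuits (As : List (BoolCircuit n)) :
    JointlyComputable n (As.map BoolCircuit.size).sum {g | g ∈ As.map BoolCircuit.eval} := by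
  induction As with
  | nil => exact empty.mono le_rfl (by simp)
  | cons A As ih =>
    refine ((of_circuit A).union ih).mono (by simp) ?_
    intro g hg
    simpa using hg

theorem exists_circuit {g : (Fin n → Bool) → Bool} (h : JointlyComputable n k S) (hg : g ∈ S) :
    ∃ A : BoolCircuit n, A.size ≤ k + 1 ∧ ∀ x, A.eval x = g x := by
  obtain ⟨m, hm, P, hP⟩ := h
  obtain ⟨i, hi⟩ := hP g hg
  -- The output must be the last vertex, hence one extra gate copying vertex `i`.
  refine ⟨⟨m, P.snoc (.gate (fun a _ => a) i i)⟩, by simp [BoolCircuit.size, hm], fun x => ?_⟩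
  exact (P.values_snoc_last _ x).trans (hi x)

/-- A full adder has five gates. -/
theorem insert_fullAdder (h : JointlyComputable n k S) {a b c : (Fin n → Bool) → Bool}
    (ha : a ∈ S) (hb : b ∈ S) (hc : c ∈ S) :
    ∃ s t : (Fin n → Bool) → Bool,
      (∀ x, (a x).toNat + (b x).toNat + (c x).toNat = (s x).toNat + 2 * (t x).toNat) ∧
      JointlyComputable n (k + 5) (insert s (insert t S)) := by
  have h1 := h.insert_gate xor ha hb
  have h2 := h1.insert_gate xor (Set.mem_insert _ _) (Set.mem_insert_of_mem _ hc)
  have h3 := h2.insert_gate and (Set.mem_insert_of_mem _ (Set.mem_insert_of_mem _ ha))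
    (Set.mem_insert_of_mem _ (Set.mem_insert_of_mem _ hb))
  have h4 := h3.insert_gate and
    (Set.mem_insert_of_mem _ (Set.mem_insert_of_mem _ (Set.mem_insert _ _)))
    (Set.mem_insert_of_mem _ (Set.mem_insert_of_mem _ (Set.mem_insert_of_mem _ hc)))
  have h5 := h4.insert_gate or (Set.mem_insert _ _) (Set.mem_insert_of_mem _ (Set.mem_insert _ _))
  refine ⟨fun x => xor (xor (a x) (b x)) (c x),
    fun x => or (and (xor (a x) (b x)) (c x)) (and (a x) (b x)), fun x => ?_, h5.mono le_rfl (Set.insert_subset ?_ (Set.insert_subset ?_ ?_))⟩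
  rotate_left
  · exact Set.mem_insert_of_mem _ (Set.mem_insert_of_mem _ (Set.mem_insert_of_mem _
      (Set.mem_insert _ _)))
  · exact Set.mem_insert _ _
  · intro g hg
    simp only [Set.mem_insert_iff]
    tauto
  · beta_reduce
    cases a x <;> cases b x <;> cases c x <;> rfl

/-- Adding bits of equal weight with a chain of full adders leaves one bit of that weight and half
as many bits of the next weight. -/
theorem exists_compress (L : List ((Fin n → Bool) → Bool)) :
    ∀ {k : ℕ} {S : Set ((Fin n → Bool) → Bool)} {s : (Fin n → Bool) → Bool},
    JointlyComputable n k S → s ∈ S → (∀ g ∈ L, g ∈ S) →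
    ∃ (t : (Fin n → Bool) → Bool) (C : List ((Fin n → Bool) → Bool)),
      C.length ≤ (L.length + 1) / 2 ∧
      (∀ x, trueCount (s :: L) x = (t x).toNat + 2 * trueCount C x) ∧
      JointlyComputable n (k + 5 * ((L.length + 1) / 2)) (insert t ({g | g ∈ C} ∪ S)) := by
  induction L using List.twoStepInduction with
  | nil =>
    intro k S s h hs _
    exact ⟨s, [], by simp, by simp, h.mono (by simp) (by simp [hs])⟩
  | singleton b =>
    intro k S s h hs hL
    have h1 := h.insert_gate xor hs (hL b (by simp))
    have h2 := h1.insert_gate and (Set.mem_insert_of_mem _ hs)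
      (Set.mem_insert_of_mem _ (hL b (by simp)))
    refine ⟨fun x => xor (s x) (b x), [fun x => s x && b x], by simp, fun x => ?_,
      h2.mono (by simp) ?_⟩
    · simp only [trueCount_cons, trueCount_nil]
      cases s x <;> cases b x <;> rfl
    · intro g hg
      simp only [Set.mem_insert_iff, Set.mem_union, Set.mem_ofPred_eq, List.mem_singleton] at hg ⊢
      tauto
  | cons_cons b c L ih _ =>
    intro k S s h hs hL
    obtain ⟨u, v, huv, h1⟩ := h.insert_fullAdder hs (hL b (by simp)) (hL c (by simp))
    obtain ⟨t, C, hC, hcount, h2⟩ := ih h1 (Set.mem_insert _ _) fun g hg =>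
      Set.mem_insert_of_mem _ (Set.mem_insert_of_mem _ (hL g (by simp [hg])))
    refine ⟨t, v :: C, ?_, fun x => ?_, h2.mono ?_ ?_⟩
    · simp only [List.length_cons]; omega
    · have := huv x
      have := hcount x
      simp only [trueCount_cons] at *
      omega
    · simp only [List.length_cons]; omega
    · intro g hg
      simp only [Set.mem_insert_iff, Set.mem_union, Set.mem_ofPred_eq, List.mem_cons] at hg ⊢
      tauto

/-- Threshold functions have circuits of linear size. -/
theorem threshold (m : ℕ) : ∀ {k : ℕ} {S : Set ((Fin n → Bool) → Bool)}
    (L : List ((Fin n → Bool) → Bool)) (τ : ℕ), JointlyComputable n k S → (∀ g ∈ L, g ∈ S) →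
    L.length ≤ m →
    JointlyComputable n (k + 10 * m + 1) {fun x => decide (τ ≤ trueCount L x)} := by
  induction m using Nat.strong_induction_on with
  | _ m ih =>
  intro k S L τ h hL hm
  have hconst (b : Bool) (hb : ∀ x, decide (τ ≤ trueCount L x) = b) :
      JointlyComputable n (k + 10 * m + 1) {fun x => decide (τ ≤ trueCount L x)} :=
    (h.insert_const b).mono (by omega) (by simp [hb])
  have hgate (op : Bool → Bool → Bool) (a b) (ha : a ∈ L) (hb : b ∈ L)
      (hop : ∀ x, decide (τ ≤ trueCount L x) = op (a x) (b x)) :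
      JointlyComputable n (k + 10 * m + 1) {fun x => decide (τ ≤ trueCount L x)} :=
    (h.insert_gate op (hL a ha) (hL b hb)).mono (by omega) (by simp [hop])
  rcases Nat.lt_or_ge L.length τ with hτ | hτ
  · refine hconst false fun x => ?_
    have : trueCount L x ≤ L.length := by
      refine (List.sum_le_card_nsmul _ 1 ?_).trans (by simp)
      simp only [List.mem_map, forall_exists_index, and_imp, forall_apply_eq_imp_iff₂]
      exact fun g _ => Bool.toNat_le _
    simp only [decide_eq_false_iff_not]
    omega
  rcases Nat.eq_zero_or_pos τ with rfl | hτ0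
  · exact hconst true fun x => by simp
  match L, hτ with
  | [], hτ => simp at hτ; omega
  | [a], hτ =>
    obtain rfl : τ = 1 := by simp at hτ; omega
    refine hgate or a a (by simp) (by simp) fun x => ?_
    cases h : a x <;> simp [h]
  | [a, b], hτ =>
    have : τ = 1 ∨ τ = 2 := by simp at hτ; omega
    rcases this with rfl | rfl
    · refine hgate or a b (by simp) (by simp) fun x => ?_
      cases h : a x <;> cases h' : b x <;> simp [h, h']
    · refine hgate and a b (by simp) (by simp) fun x => ?_
      cases h : a x <;> cases h' : b x <;> simp [h, h']
  | s :: b :: c :: L, hτ =>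
    obtain ⟨t, C, hC, hcount, h2⟩ := h.exists_compress (b :: c :: L) (hL s (by simp))
      fun g hg => hL g (List.mem_cons_of_mem _ hg)
    simp only [List.length_cons] at hm hC h2
    -- With total `t + 2 * C`, a threshold `2u` amounts to `C ≥ u`, and `2u + 1` to `t + C ≥ u + 1`.
    -- The odd case needs `5 * (m / 2) + 10 * (m / 2 + 1) ≤ 10 * m`, which is tight at `m = 4`.
    rcases Nat.even_or_odd' τ with ⟨u, rfl | rfl⟩
    · refine (ih (m / 2) (by omega) C u h2 (fun g hg => by simp [hg]) (by omega)).mono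
        (by omega) ?_
      simp only [Set.singleton_subset_iff, Set.mem_singleton_iff]
      funext x
      rw [hcount, decide_eq_decide]
      have := Bool.toNat_le (t x)
      omega
    · refine (ih (m / 2 + 1) (by omega) (t :: C) (u + 1) h2 (fun g hg => ?_) ?_).mono
        (by omega) ?_
      · simp only [List.mem_cons] at hg
        simp only [Set.mem_insert_iff, Set.mem_union, Set.mem_ofPred_eq]
        tauto
      · simp only [List.length_cons]; omega
      simp only [Set.singleton_subset_iff, Set.mem_singleton_iff]
      funext x
      rw [hcount, trueCount_cons, decide_eq_decide]
      have := Bool.toNat_le (t x)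
      omega

end JointlyComputable

/-- A threshold of given circuits is computed by a circuit whose size exceeds the sum of their sizes
by a linear amount. -/
theorem BoolCircuit.exists_threshold {n : ℕ} (As : List (BoolCircuit n)) (τ : ℕ) :
    ∃ A : BoolCircuit n, A.size ≤ (As.map BoolCircuit.size).sum + 10 * As.length + 2 ∧
      ∀ x, A.eval x = decide (τ ≤ trueCount (As.map BoolCircuit.eval) x) :=
  ((JointlyComputable.of_circuits As).threshold As.length (As.map BoolCircuit.eval) τ
    (fun _ hg => hg) (by simp)).exists_circuit (Set.mem_singleton _)

/-! ### Boosting with capped exponential weights -/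

/-- The convex function with derivative `min 1 (exp u)`. -/
noncomputable def cappedExp (u : ℝ) : ℝ := if u ≤ 0 then Real.exp u else u + 1

theorem cappedExp_le_exp (u : ℝ) : cappedExp u ≤ Real.exp u := by
  unfold cappedExp
  split_ifs
  · exact le_rfl
  · exact Real.add_one_le_exp u

/-- Lets a small potential control the hinge loss. -/
theorem le_cappedExp (u : ℝ) : max 0 u ≤ cappedExp u := by
  unfold cappedExp
  split_ifs with h
  · rw [max_eq_left h]; positivity
  · rw [max_eq_right (by linarith)]; linarith

/-- Convexity: the graph lies above its tangents. This makes the shift that balances the weights a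
minimiser of the potential. -/
theorem cappedExp_tangent_le (u w : ℝ) :
    cappedExp u + min 1 (Real.exp u) * (w - u) ≤ cappedExp w := by
  have hw := Real.add_one_le_exp w
  rcases le_or_gt u 0 with hu | hu
  · have h1 : Real.exp u ≤ 1 := Real.exp_le_one_iff.2 hu
    have h2 : Real.exp u * (w - u + 1) ≤ Real.exp w := by
      calc _ ≤ Real.exp u * Real.exp (w - u) := by gcongr; exact Real.add_one_le_exp _
        _ = _ := by rw [← Real.exp_add]; ring_nf
    have h3 : Real.exp u * (-u + 1) ≤ 1 := by
      calc _ ≤ Real.exp u * Real.exp (-u) := by gcongr; exact Real.add_one_le_exp _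
        _ = _ := by rw [← Real.exp_add]; simp
    rw [min_eq_right h1, cappedExp, cappedExp, if_pos hu]
    split_ifs with hw0
    · linarith
    · nlinarith
  · rw [min_eq_left (Real.one_le_exp hu.le), cappedExp, cappedExp, if_neg (not_le.2 hu)]
    split_ifs with hw0 <;> linarith

/-- The second-order error is proportional to the weight itself, so a boosting step loses only `d²`
times the total mass `ε`. -/
theorem cappedExp_add_le (u : ℝ) {d : ℝ} (hd : |d| ≤ 1) :
    cappedExp (u + d) ≤ cappedExp u + min 1 (Real.exp u) * (d + d ^ 2) := by
  have hexp {y : ℝ} (hy : |y| ≤ 1) : Real.exp y ≤ 1 + y + y ^ 2 := by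
    have := (abs_le.1 (Real.abs_exp_sub_one_sub_id_le hy)).2
    linarith
  rcases le_or_gt u 0 with hu | hu
  · rw [min_eq_right (Real.exp_le_one_iff.2 hu)]
    calc cappedExp (u + d) ≤ Real.exp u * Real.exp d := by
          rw [← Real.exp_add]; exact cappedExp_le_exp _
      _ ≤ Real.exp u * (1 + d + d ^ 2) := by gcongr; exact hexp hd
      _ = _ := by rw [cappedExp, if_pos hu]; ring
  · rw [min_eq_left (Real.one_le_exp hu.le), cappedExp, cappedExp, if_neg (not_le.2 hu)]
    split_ifs with h
    · have hd' := abs_le.1 hd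
      have := hexp (y := u + d) (abs_le.2 ⟨by linarith, by linarith⟩)
      nlinarith
    · nlinarith [sq_nonneg d]

variable {X ι : Type*} [Fintype X]

/-- A shift of any potential gives capped exponential weights of prescribed total mass. -/
theorem exists_shift_weights (v : X → ℝ) (hv : ∀ x, 0 ≤ v x) (hv1 : ∑ x, v x = 1)
    {ε : ℝ} (hε : 0 < ε) (hε1 : ε ≤ 1) (F : X → ℝ) :
    ∃ r : ℝ, ∑ x, v x * min 1 (Real.exp (F x - r)) = ε := by
  obtain ⟨B, hB⟩ : ∃ B, ∀ x, |F x| ≤ B :=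
    ⟨∑ x, |F x|, fun x => Finset.single_le_sum (f := fun x => |F x|)
      (fun _ _ => abs_nonneg _) (Finset.mem_univ x)⟩
  have hcont : Continuous fun r : ℝ => ∑ x, v x * min 1 (Real.exp (F x - r)) := by fun_prop
  -- At `r = B - log ε` every weight is at most `ε`; at `r = -B` every weight is 1.
  refine mem_range_of_exists_le_of_exists_ge hcont ⟨B - Real.log ε, ?_⟩ ⟨-B, ?_⟩
  · calc _ ≤ ∑ x, v x * ε := by
          refine Finset.sum_le_sum fun x _ => mul_le_mul_of_nonneg_left ?_ (hv x)
          refine (min_le_right _ _).trans ?_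
          rw [← Real.le_log_iff_exp_le hε]
          have := (abs_le.1 (hB x)).2
          linarith
      _ = ε := by rw [← Finset.sum_mul, hv1, one_mul]
  · refine (hε1.trans hv1.ge).trans ?_
    refine Finset.sum_le_sum fun x _ => ?_
    rw [min_eq_left (Real.one_le_exp (by have := (abs_le.1 (hB x)).1; linarith)), mul_one]

/-- Boosting with capped exponential weights: if every density of mass `ε` is correlated with some
`χ a`, then the potential of suitable sums of the `χ a` drops by a constant in each round. -/
theorem exists_boosting (v : X → ℝ) (hv : ∀ x, 0 ≤ v x) (hv1 : ∑ x, v x = 1)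
    {ε δ : ℝ} (hε : 0 < ε) (hε1 : ε ≤ 1) (hδ : 0 < δ) (hδ1 : δ < 1)
    (χ : ι → X → ℝ) (hχ : ∀ a x, |χ a x| ≤ 1) (p : ι → Prop)
    (hweak : ∀ h : X → ℝ, (∀ x, 0 ≤ h x) → (∀ x, h x ≤ 1) → ∑ x, v x * h x = ε →
      ∃ a, p a ∧ ε * δ ≤ ∑ x, v x * h x * χ a x) (t : ℕ) :
    ∃ l : List ι, l.length = t ∧ (∀ a ∈ l, p a) ∧ ∃ r : ℝ,
      ε * r + ∑ x, v x * cappedExp (-(δ / 2) * (l.map (χ · x)).sum - r) ≤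
        ε * (Real.log (1 / ε) + 1 - t * (δ ^ 2 / 4)) := by
  induction t with
  | zero =>
    refine ⟨[], rfl, by simp, Real.log (1 / ε), ?_⟩
    have h : cappedExp (-Real.log (1 / ε)) ≤ ε := by
      refine (cappedExp_le_exp _).trans ?_
      rw [one_div, Real.log_inv, neg_neg, Real.exp_log hε]
    simp only [List.map_nil, List.sum_nil, mul_zero, zero_sub, ← Finset.sum_mul, hv1, one_mul]
    push_cast
    linarith
  | succ t ih =>
    obtain ⟨l, hlen, hp, r₀, hr₀⟩ := ih
    set F : X → ℝ := fun x => -(δ / 2) * (l.map (χ · x)).sum with hF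
    obtain ⟨r, hr⟩ := exists_shift_weights v hv hv1 hε hε1 F
    obtain ⟨a, hpa, ha⟩ := hweak (fun x => min 1 (Real.exp (F x - r)))
      (fun x => le_min zero_le_one (Real.exp_pos _).le) (fun x => min_le_left _ _) hr
    refine ⟨a :: l, by simp [hlen], by simpa [hpa] using hp, r, ?_⟩
    -- The derivative in `r` is `ε` minus the total weight, which vanishes at the new `r`.
    have hmin : ε * r + ∑ x, v x * cappedExp (F x - r) ≤
        ε * r₀ + ∑ x, v x * cappedExp (F x - r₀) := by
      have : ∑ x, v x * (cappedExp (F x - r) + min 1 (Real.exp (F x - r)) * (r - r₀)) ≤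
          ∑ x, v x * cappedExp (F x - r₀) := by
        refine Finset.sum_le_sum fun x _ => mul_le_mul_of_nonneg_left ?_ (hv x)
        have := cappedExp_tangent_le (F x - r) (F x - r₀)
        rwa [show F x - r₀ - (F x - r) = r - r₀ by ring] at this
      simp only [mul_add, Finset.sum_add_distrib, ← mul_assoc, ← Finset.sum_mul, hr] at this
      linarith
    -- The gain is at least `(δ/2) * ε δ` and the second-order loss at most `ε δ² / 4`; step size `δ
    -- / 2` leaves a drop of `ε δ² / 4`.
    have hstep : ∑ x, v x * cappedExp (-(δ / 2) * ((a :: l).map (χ · x)).sum - r) ≤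
        ∑ x, (v x * cappedExp (F x - r) -
          (δ / 2) * (v x * min 1 (Real.exp (F x - r)) * χ a x) +
          (δ ^ 2 / 4) * (v x * min 1 (Real.exp (F x - r)))) := by
      refine Finset.sum_le_sum fun x _ => ?_
      have hχx := abs_le.1 (hχ a x)
      have hsq : (χ a x) ^ 2 ≤ 1 := by nlinarith
      have h1 := cappedExp_add_le (F x - r) (d := -(δ / 2) * χ a x)
        (abs_le.2 ⟨by nlinarith, by nlinarith⟩)
      have h2 : (-(δ / 2) * ((a :: l).map (χ · x)).sum - r) = F x - r + -(δ / 2) * χ a x := by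
        simp only [List.map_cons, List.sum_cons, hF]; ring
      have hw : 0 ≤ min 1 (Real.exp (F x - r)) := le_min zero_le_one (Real.exp_pos _).le
      have h3 : min 1 (Real.exp (F x - r)) * (-(δ / 2) * χ a x) ^ 2 ≤
          min 1 (Real.exp (F x - r)) * (δ ^ 2 / 4) := by
        refine mul_le_mul_of_nonneg_left ?_ hw
        nlinarith [sq_nonneg δ]
      rw [h2]
      have h4 := mul_le_mul_of_nonneg_left h1 (hv x)
      have h5 := mul_le_mul_of_nonneg_left h3 (hv x)
      linarith
    simp only [Finset.sum_add_distrib, Finset.sum_sub_distrib, ← Finset.mul_sum, hr] at hstep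
    push_cast
    nlinarith

/-! ### From margins to a threshold, and from densities to events -/

/-- The failure probability of a random threshold in `[-θ, θ]` is governed by the margins. -/
theorem exists_threshold_failure_lt (v : X → ℝ) (hv : ∀ x, 0 ≤ v x)
    (f : X → Bool) (σ : X → ℝ) {θ ε : ℝ} (hθ : 0 < θ)
    (hmargin : ∑ x, v x * max 0 (θ - (if f x then σ x else -σ x)) < ε * θ) :
    ∃ r : ℝ, ∑ x, v x * (if decide (r < σ x) = f x then 0 else 1) < ε / 2 := by
  by_contra! hcon
  have hfun (x : X) : (fun r : ℝ => if decide (r < σ x) = f x then (0 : ℝ) else 1) =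
      (if f x then Set.Ici (σ x) else Set.Iio (σ x)).indicator 1 := by
    funext r
    cases f x <;> simp [Set.indicator_apply, ← not_lt, ite_not]
  have hmeas (x : X) : MeasurableSet (if f x then Set.Ici (σ x) else Set.Iio (σ x)) := by
    split_ifs
    exacts [measurableSet_Ici, measurableSet_Iio]
  have hint (x : X) :
      IntervalIntegrable (fun r : ℝ => if decide (r < σ x) = f x then (0 : ℝ) else 1)
        volume (-θ) θ := by
    rw [hfun, intervalIntegrable_iff]
    exact IntegrableOn.indicator (integrableOn_const (by simp) (by simp)) (hmeas x)
  -- The thresholds that fail at `x` form a half-line, cut to `[-θ, θ]`.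
  have hbound (x : X) : ∫ r in (-θ)..θ, (if decide (r < σ x) = f x then (0 : ℝ) else 1) ≤
      max 0 (θ - (if f x then σ x else -σ x)) := by
    rw [hfun, intervalIntegral.integral_of_le (by linarith), integral_indicator_one (hmeas x),
      measureReal_restrict_apply (hmeas x), max_comm]
    cases f x
    · simp only [Bool.false_eq_true, if_false]
      calc _ ≤ volume.real (Set.Icc (-θ) (σ x)) :=
            measureReal_mono (fun r hr => ⟨hr.2.1.le, le_of_lt hr.1⟩) (by simp)
        _ = _ := by rw [Real.volume_real_Icc]; ring_nf
    · simp only [if_true]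
      calc _ ≤ volume.real (Set.Icc (σ x) θ) :=
            measureReal_mono (fun r hr => ⟨hr.1, hr.2.2⟩) (by simp)
        _ = _ := Real.volume_real_Icc
  have h1 : ∫ r in (-θ)..θ, ε / 2 ≤
      ∫ r in (-θ)..θ, ∑ x, v x * (if decide (r < σ x) = f x then (0 : ℝ) else 1) := by
    refine intervalIntegral.integral_mono (by linarith) (by simp) ?_ hcon
    simpa only [Finset.sum_fn] using
      IntervalIntegrable.sum Finset.univ fun x _ => (hint x).const_mul (v x)
  rw [intervalIntegral.integral_finsetSum fun x _ => (hint x).const_mul _] at h1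
  simp only [intervalIntegral.integral_const_mul, intervalIntegral.integral_const,
    smul_eq_mul] at h1
  have h2 := Finset.sum_le_sum fun x (_ : x ∈ Finset.univ) =>
    mul_le_mul_of_nonneg_left (hbound x) (hv x)
  nlinarith

/-- A density on a finite probability space is realised by an event on an extension of the space. -/
theorem exists_event_of_density {X : Type} [Fintype X] [MeasurableSpace X]
    [MeasurableSingletonClass X] (V : Measure X) [IsProbabilityMeasure V] (h : X → ℝ)
    (h0 : ∀ x, 0 ≤ h x) (h1 : ∀ x, h x ≤ 1) :
    ∃ (Ω : Type) (_ : MeasurableSpace Ω) (P : Measure Ω) (_ : IsProbabilityMeasure P)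
      (Y : Ω → X) (E : Set Ω), Measurable Y ∧ P.map Y = V ∧ MeasurableSet E ∧
      ∀ p : X → Prop, [DecidablePred p] →
        P.real (E ∩ {ω | p (Y ω)}) = ∑ x, V.real {x} * h x * (if p x then 1 else 0) := by
  -- The event is the region under the graph of `h` in `X × [0, 1]`.
  let H : X → unitInterval := fun x => ⟨h x, h0 x, h1 x⟩
  have hE : MeasurableSet {ω : X × unitInterval | ω.2 ≤ H ω.1} :=
    measurableSet_le measurable_snd ((measurable_of_finite H).comp measurable_fst)
  refine ⟨X × unitInterval, inferInstance, V.prod volume, inferInstance, Prod.fst,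
    {ω | ω.2 ≤ H ω.1}, measurable_fst, measurePreserving_fst.map_eq, hE, fun p _ => ?_⟩
  have hp : MeasurableSet {ω : X × unitInterval | p ω.1} :=
    measurable_fst (Set.toFinite {x | p x}).measurableSet
  rw [measureReal_def, Measure.prod_apply (hE.inter hp), lintegral_fintype,
    ENNReal.toReal_sum fun x _ => ENNReal.mul_ne_top (measure_ne_top _ _) (measure_ne_top _ _)]
  refine Finset.sum_congr rfl fun x _ => ?_
  rw [ENNReal.toReal_mul, ← measureReal_def, ← measureReal_def]
  by_cases hx : p x
  · have : Prod.mk x ⁻¹' ({ω | ω.2 ≤ H ω.1} ∩ {ω : X × unitInterval | p ω.1}) =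
        Set.Iic (H x) := by
      ext; simp [hx]
    rw [this, measureReal_def, unitInterval.volume_Iic, ENNReal.toReal_ofReal (h0 x), if_pos hx]
    ring
  · have : Prod.mk x ⁻¹' ({ω | ω.2 ≤ H ω.1} ∩ {ω : X × unitInterval | p ω.1}) = ∅ := by
      ext; simp [hx]
    simp [this, hx]

theorem measureReal_setOf_eq_sum {X : Type*} [Fintype X] [MeasurableSpace X]
    [MeasurableSingletonClass X] (V : Measure X) [IsFiniteMeasure V] (p : X → Prop)
    [DecidablePred p] : V.real {x | p x} = ∑ x, V.real {x} * (if p x then 1 else 0) := by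
  simp only [mul_ite, mul_one, mul_zero, ← Finset.sum_filter]
  rw [sum_measureReal_singleton]
  simp

theorem exists_nat_threshold (ρ : ℝ) : ∃ τ : ℕ, ∀ N : ℕ, ρ < N ↔ τ ≤ N := by
  rcases lt_or_ge ρ 0 with h | h
  · exact ⟨0, fun N => ⟨fun _ => Nat.zero_le _, fun _ => h.trans_le N.cast_nonneg⟩⟩
  · exact ⟨⌊ρ⌋₊ + 1, fun N => by rw [Nat.succ_le_iff, Nat.floor_lt h]⟩

/-! ### The boosted predictor and the size count -/

/-- The correlation of a circuit with `f` at the input `x`. -/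
def BoolCircuit.agreement {n : ℕ} (f : (Fin n → Bool) → Bool) (A : BoolCircuit n)
    (x : Fin n → Bool) : ℝ := if A.eval x = f x then 1 else -1

/-- Identifies the signed margin of the centred vote count with the sum that boosting controls. -/
theorem sum_agreement {n : ℕ} (f : (Fin n → Bool) → Bool) (l : List (BoolCircuit n))
    (x : Fin n → Bool) :
    (if f x then 2 * (trueCount (l.map BoolCircuit.eval) x : ℝ) - l.length
      else -(2 * (trueCount (l.map BoolCircuit.eval) x : ℝ) - l.length)) =
      (l.map (BoolCircuit.agreement f · x)).sum := by
  induction l with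
  | nil => simp
  | cons A l ih =>
    simp only [List.map_cons, List.sum_cons, ← ih, trueCount_cons,
      List.length_cons]
    rw [BoolCircuit.agreement]
    cases f x <;> cases A.eval x <;> simp <;> ring

/-- If every density of mass `ε` is predicted with advantage `δ` by one of the circuits satisfying
`p`, then some threshold of `t` such circuits fails with probability less than `ε / 2`. -/
theorem exists_threshold_predictor {n : ℕ} (v : (Fin n → Bool) → ℝ) (hv : ∀ x, 0 ≤ v x)
    (hv1 : ∑ x, v x = 1) (f : (Fin n → Bool) → Bool) {ε δ : ℝ} (hε : 0 < ε) (hε1 : ε ≤ 1)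
    (hδ : 0 < δ) (hδ1 : δ < 1) (p : BoolCircuit n → Prop)
    (hweak : ∀ h : (Fin n → Bool) → ℝ, (∀ x, 0 ≤ h x) → (∀ x, h x ≤ 1) → ∑ x, v x * h x = ε →
      ∃ A, p A ∧ ε * δ ≤ ∑ x, v x * h x * A.agreement f x) {t : ℕ}
    (ht : 4 * (Real.log (1 / ε) + 1) / δ ^ 2 < t) :
    ∃ (l : List (BoolCircuit n)) (τ : ℕ), l.length = t ∧ (∀ A ∈ l, p A) ∧
      ∑ x, v x * (if decide (τ ≤ trueCount (l.map BoolCircuit.eval) x) = f x then 0 else 1) <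
        ε / 2 := by
  obtain ⟨l, hlen, hl, r, hr⟩ := exists_boosting v hv hv1 hε hε1 hδ hδ1
    (fun A x => A.agreement f x) (fun A x => by unfold BoolCircuit.agreement; split_ifs <;> simp)
    p hweak t
  have hneg : ε * (Real.log (1 / ε) + 1 - t * (δ ^ 2 / 4)) < 0 := by
    refine mul_neg_of_pos_of_neg hε ?_
    rw [div_lt_iff₀ (by positivity)] at ht
    linarith
  have hsum : ∑ x, v x * max 0 (-(δ / 2) * (l.map (BoolCircuit.agreement f · x)).sum - r) ≤
      ∑ x, v x * cappedExp (-(δ / 2) * (l.map (BoolCircuit.agreement f · x)).sum - r) :=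
    Finset.sum_le_sum fun x _ => mul_le_mul_of_nonneg_left (le_cappedExp _) (hv x)
  have hsum0 : 0 ≤ ∑ x, v x *
      max 0 (-(δ / 2) * (l.map (BoolCircuit.agreement f · x)).sum - r) :=
    Finset.sum_nonneg fun x _ => mul_nonneg (hv x) (le_max_left _ _)
  have hr0 : r < 0 := by
    by_contra! h
    have := mul_nonneg hε.le h
    linarith
  -- Dividing the hinge `-(δ/2) σ - r` by `δ / 2` gives margin `θ = -2r/δ`, positive because `r <
  -- 0`.
  obtain ⟨ρ, hρ⟩ := exists_threshold_failure_lt v hv f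
    (fun x => 2 * (trueCount (l.map BoolCircuit.eval) x : ℝ) - l.length)
    (θ := 2 / δ * -r) (ε := ε) (by have : 0 < 2 / δ := by positivity
                                   nlinarith) <| by
    simp only [sum_agreement]
    calc _ = 2 / δ * ∑ x, v x *
          max 0 (-(δ / 2) * (l.map (BoolCircuit.agreement f · x)).sum - r) := by
          rw [Finset.mul_sum]
          refine Finset.sum_congr rfl fun x _ => ?_
          rw [mul_left_comm, mul_max_of_nonneg _ _ (by positivity : 0 ≤ 2 / δ)]
          congr 2
          · simp
          · field_simp
            ring
      _ < 2 / δ * (ε * -r) := by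
          gcongr
          linarith
      _ = _ := by ring
  obtain ⟨τ, hτ⟩ := exists_nat_threshold ((ρ + l.length) / 2)
  refine ⟨l, τ, hlen, hl, ?_⟩
  convert hρ using 6 with x
  rw [← hτ, div_lt_iff₀ two_pos]
  constructor <;> intro h <;> linarith

theorem mainTheorem2 :
    ∃ c : ℝ, 0 < c ∧
      ∀ (n : ℕ) (V : Measure (Fin n → Bool)) (_ : IsProbabilityMeasure V)
        (f : (Fin n → Bool) → Bool) (s : ℕ) (ε δ : ℝ),
        0 < ε → ε ≤ 1 → 0 < δ → δ < 1 →
        (∀ A : BoolCircuit n, A.size ≤ s → V.real {x | A.eval x = f x} ≤ 1 - ε / 2) →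
        ∃ (Ω : Type) (_ : MeasurableSpace Ω) (P : Measure Ω) (_ : IsProbabilityMeasure P)
          (X : Ω → (Fin n → Bool)) (E : Set Ω),
          Measurable X ∧ P.map X = V ∧ MeasurableSet E ∧ P.real E = ε ∧
          ∀ A : BoolCircuit n, (A.size : ℝ) ≤ c * (s * δ ^ 2 / Real.log (2 / ε)) →
            (P[|E]).real {ω | A.eval (X ω) = f (X ω)} ≤ (1 + δ) / 2 := by
  refine ⟨1 / 200, by norm_num, fun n V _ f s ε δ hε hε1 hδ hδ1 hunpred => ?_⟩
  by_contra hcon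
  set B : ℝ := 1 / 200 * (s * δ ^ 2 / Real.log (2 / ε)) with hB
  have hv1 : ∑ x, V.real {x} = 1 := by
    rw [sum_measureReal_singleton, Finset.coe_univ, probReal_univ]
  have hweak (h : (Fin n → Bool) → ℝ) (h0 : ∀ x, 0 ≤ h x) (h1 : ∀ x, h x ≤ 1)
      (hmass : ∑ x, V.real {x} * h x = ε) : ∃ A : BoolCircuit n, (A.size : ℝ) ≤ B ∧
        ε * δ ≤ ∑ x, V.real {x} * h x * A.agreement f x := by
    by_contra! hall
    obtain ⟨Ω, _, P, _, Y, E, hY, hPV, hE, hPE⟩ := exists_event_of_density V h h0 h1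
    have hPE' : P.real E = ε := by simpa [hmass] using hPE fun _ => True
    refine hcon ⟨Ω, _, P, ‹_›, Y, E, hY, hPV, hE, hPE', fun A hA => ?_⟩
    rw [measureReal_def, cond_apply hE, ENNReal.toReal_mul, ENNReal.toReal_inv, ← measureReal_def,
      ← measureReal_def, hPE', hPE fun x => A.eval x = f x, inv_mul_le_iff₀ hε]
    have h2 : ∑ x, V.real {x} * h x * A.agreement f x =
        2 * ∑ x, V.real {x} * h x * (if A.eval x = f x then 1 else 0) - ε := by
      rw [← hmass, Finset.mul_sum, ← Finset.sum_sub_distrib]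
      refine Finset.sum_congr rfl fun x _ => ?_
      unfold BoolCircuit.agreement
      split_ifs <;> ring
    have := hall A hA
    linarith
  -- The constant density `ε` already yields a circuit, and circuits have at least one vertex. This
  -- absorbs the overhead `10 t + 2` into `12 t B`.
  have hB1 : 1 ≤ B := by
    obtain ⟨A, hA, -⟩ := hweak (fun _ => ε) (fun _ => hε.le) (fun _ => hε1)
      (by rw [← Finset.sum_mul, hv1, one_mul])
    refine le_trans ?_ hA
    exact_mod_cast Nat.succ_le_succ (Nat.zero_le A.pred)
  have hlog : 0 ≤ Real.log (1 / ε) := Real.log_nonneg (by rw [le_div_iff₀ hε]; linarith)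
  have hlog2 : Real.log (2 / ε) = Real.log 2 + Real.log (1 / ε) := by
    rw [← Real.log_mul two_ne_zero (by positivity), mul_one_div]
  have hlog_le : 5 * (Real.log (1 / ε) + 1) ≤ 8 * Real.log (2 / ε) := by
    have := Real.log_two_gt_d9
    linarith
  have hδ2 : δ ^ 2 ≤ 1 := pow_le_one₀ hδ.le hδ1.le
  set t : ℕ := ⌊4 * (Real.log (1 / ε) + 1) / δ ^ 2⌋₊ + 1 with ht
  have ht_le : (t : ℝ) * δ ^ 2 ≤ 8 * Real.log (2 / ε) := by
    have h1 : (t : ℝ) ≤ 4 * (Real.log (1 / ε) + 1) / δ ^ 2 + 1 := by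
      rw [ht]
      push_cast
      gcongr
      exact Nat.floor_le (by positivity)
    calc (t : ℝ) * δ ^ 2 ≤ (4 * (Real.log (1 / ε) + 1) / δ ^ 2 + 1) * δ ^ 2 := by gcongr
      _ = 4 * (Real.log (1 / ε) + 1) + δ ^ 2 := by field_simp
      _ ≤ _ := by linarith
  obtain ⟨l, τ, hlen, hl, hfail⟩ := exists_threshold_predictor (fun x => V.real {x})
    (fun _ => measureReal_nonneg) hv1 f hε hε1 hδ hδ1 (fun A => (A.size : ℝ) ≤ B) hweak
    (t := t) (by rw [ht]; exact_mod_cast Nat.lt_floor_add_one _)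
  obtain ⟨A, hAsize, hA⟩ := BoolCircuit.exists_threshold l τ
  have hsize : A.size ≤ s := by
    have h1 : (l.map BoolCircuit.size).sum ≤ t * ⌊B⌋₊ := by
      refine (List.sum_le_card_nsmul _ ⌊B⌋₊ ?_).trans (by simp [hlen])
      simp only [List.mem_map, forall_exists_index, and_imp, forall_apply_eq_imp_iff₂]
      exact fun a ha => Nat.le_floor (hl a ha)
    have h2 : (A.size : ℝ) ≤ t * ⌊B⌋₊ + 10 * t + 2 := by
      rw [hlen] at hAsize
      exact_mod_cast hAsize.trans (by omega)
    have h3 : (⌊B⌋₊ : ℝ) ≤ B := Nat.floor_le (by linarith)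
    have h4 : (1 : ℝ) ≤ t := by exact_mod_cast Nat.succ_pos _
    have h5 : (t : ℝ) * B ≤ 8 / 200 * s := by
      have hpos : 0 < Real.log (2 / ε) := by linarith
      calc (t : ℝ) * B = (t * δ ^ 2) * (s / (200 * Real.log (2 / ε))) := by rw [hB]; ring
        _ ≤ (8 * Real.log (2 / ε)) * (s / (200 * Real.log (2 / ε))) := by gcongr
        _ = _ := by field_simp
    -- The total is at most `13 t B ≤ (104 / 200) s`.
    have h6 : (A.size : ℝ) ≤ s := by nlinarith [Nat.cast_nonneg (α := ℝ) s]
    exact_mod_cast h6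
  have hsucc := hunpred A hsize
  rw [measureReal_setOf_eq_sum] at hsucc
  have htotal : ∑ x, V.real {x} * (if A.eval x = f x then 1 else 0) +
      ∑ x, V.real {x} *
        (if decide (τ ≤ trueCount (l.map BoolCircuit.eval) x) = f x then 0 else 1) = 1 := by
    rw [← Finset.sum_add_distrib, ← hv1]
    refine Finset.sum_congr rfl fun x _ => ?_
    rw [hA]
    split_ifs <;> simp
  linarith
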